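/- Let $K$ be a field and $N\ge 3$. The affine nilTemperley-Lieb algebra $\widehat{nTL}_N$ is the unital associative $K$-algebra with generators $a_i$, $i\in\mathbb Z/N\mathbb Z$, and relations $a_i^2=0$, $a_ia_j=a_ja_i$ for $i-j\ne\pm1$, and $a_ia_{i+1}a_i=a_{i+1}a_ia_{i+1}=0$. For a sequence $\underline j=(j_1,\dots,j_m)$ in $\mathbb Z/N\mathbb Z$ put $a(\underline j)=a_{j_1}\cdots a_{j_m}$; for $i\in\mathbb Z/N\mathbb Z$ let ${}^i nTL_N$ be the subalgebra generated by all $a_m$ with $m\neq i$ (a copy of the finite nilTemperley-Lieb algebra). A particle configuration is a subset $S\subseteq\mathbb Z/N\mathbb Z$. The generator $a_i$ acts nontrivially on $S$ if and only if $i\in S$ and $i+1\notin S$, and then it moves $S$ to $(S\setminus\{i\})\cup\{i+1\}$; a word $\underline j$ acts by letting its letters act one after the other, the last letter first, and it acts nontrivially on $S$ if every letter does so on the configuration it meets. For a nonempty proper subset $I=\{i_1<\dots<i_k\}$ of $\{1,\dots,N\}$ (identified with $\mathbb Z/N\mathbb Z$) choose $i_\ell\in I$ whose cyclic successor $i_\ell+1$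 is not in $I$, and let $$a(\hat I)=(a_{i_1-1}a_{i_1-2}\cdots a_{i_k+1})\cdot\prod_{s=1}^{k-1}(a_{i_{s+1}-1}a_{i_{s+1}-2}\cdots a_{i_s+1})\cdot(a_{i_{\ell+1}}\cdots a_{i_k})\cdot(a_{i_1}\cdots a_{i_\ell}),$$ with indices modulo $N$; this element does not depend on the choice of $i_\ell$. For $1\le k\le N-1$ let $\mathbf t_k=(-1)^{k-1}\sum_{|I|=k}a(\hat I)$. **Theorem.** (a) $\widehat{nTL}_N$ is finitely generated as a module over its center. (b) The elements $\mathbf t_1,\dots,\mathbf t_{N-1}$ are central, and for every sequence $\underline j$ there are $i\in\mathbb Z/N\mathbb Z$, a monomial $a_{\mathrm{fin}}$ in the generators $a_m$ with $m\ne i$ (so $a_{\mathrm{fin}}\in{}^i nTL_N$), integers $1\le k\le N-1$ and $n\ge 0$, and a sequence $\underline j^{(0)}$ without repeated entries, such that $$a(\underline j)=(-1)^{n(k-1)}\,a_{\mathrm{fin}}\cdot \mathbf t_k^{\,n}\cdot a(\underline j^{(0)}).$$ Moreover, if $a(\underline j)\ne0$, then the set of entries of $\underline j^{(0)}$ is the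 least particle configuration (with respect to inclusion) on which $\underline j$ acts nontrivially, and, unless $\underline j$ is empty, $k$ is the length of $\underline j^{(0)}$. -/

import Mathlib

noncomputable section

namespace AffineNilTL

/-- The defining relations of the affine nilTemperley-Lieb algebra, on the free algebra with
generators indexed by `ZMod N`. -/
inductive Rel (K : Type*) [Field K] (N : ℕ) :
    FreeAlgebra K (ZMod N) → FreeAlgebra K (ZMod N) → Prop
  | sq (i : ZMod N) : Rel K N (FreeAlgebra.ι K i * FreeAlgebra.ι K i) 0
  | comm (i j : ZMod N) (h₁ : i - j ≠ 1) (h₂ : i - j ≠ -1) :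
      Rel K N (FreeAlgebra.ι K i * FreeAlgebra.ι K j) (FreeAlgebra.ι K j * FreeAlgebra.ι K i)
  | braid (i : ZMod N) :
      Rel K N (FreeAlgebra.ι K i * FreeAlgebra.ι K (i + 1) * FreeAlgebra.ι K i) 0
  | braid' (i : ZMod N) :
      Rel K N (FreeAlgebra.ι K (i + 1) * FreeAlgebra.ι K i * FreeAlgebra.ι K (i + 1)) 0

/-- The affine nilTemperley-Lieb algebra of rank `N` over `K`. -/
abbrev Alg (K : Type*) [Field K] (N : ℕ) : Type _ := RingQuot (Rel K N)

/-- The generator `a_i`, with `i` taken modulo `N`. -/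
def gen (K : Type*) [Field K] {N : ℕ} (i : ZMod N) : Alg K N :=
  RingQuot.mkAlgHom K (Rel K N) (FreeAlgebra.ι K i)

/-- The monomial `a(j) = a_{j_1} ⋯ a_{j_m}` of an index sequence `j = (j_1, …, j_m)`. -/
def monomial (K : Type*) [Field K] {N : ℕ} (j : List (ZMod N)) : Alg K N :=
  (j.map (gen K)).prod

/-- The copy of the finite nilTemperley-Lieb algebra generated by all `a_m` with `m ≠ i`. -/
def finiteCopy (K : Type*) [Field K] {N : ℕ} (i : ZMod N) : Subalgebra K (Alg K N) :=
  Algebra.adjoin K (gen K '' {m | m ≠ i})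

/-- Motion of particles on a circle with positions `ZMod N`, at most one particle per position.
The generator `a_i` moves a particle from `i` to `i + 1`; it kills (`none`) every configuration
without a particle at `i` or with a particle at `i + 1`. As in a product of operators, the last
letter of the word acts first. Up to a nonzero scalar (a sign and a power of `q`) this is the
action of the monomial on the wedge basis of the fermionic representation. -/
def act {N : ℕ} : List (ZMod N) → Finset (ZMod N) → Option (Finset (ZMod N))
  | [], S => some S
  | i :: j, S => (act j S).bind fun T =>
      if i ∈ T ∧ i + 1 ∉ T then some (insert (i + 1) (T.erase i)) else none

/-- The configurations on which the word `j` acts nontrivially. -/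
def support {N : ℕ} (j : List (ZMod N)) : Set (Finset (ZMod N)) :=
  {S | act j S ≠ none}

/-- A position of `I` whose successor is not in `I`; it exists when `I` is nonempty and proper. -/
def gap {N : ℕ} (I : Finset (ZMod N)) : ZMod N :=
  Classical.epsilon fun g => g ∈ I ∧ g + 1 ∉ I

/-- The index sequence of the monomial `a(Î)`, for a configuration `I = {i_1 < ⋯ < i_k}` and a gap
`g = i_ℓ`. Its right part consists of the indices in `I` in the cyclically increasing order
`g + 1, g + 2, …, g`, which is `(i_{ℓ+1}, …, i_k, i_1, …, i_ℓ)`. Its left part consists of the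
indices outside `I` in the cyclically decreasing order `g, g - 1, …, g + 1`, which is the
concatenation of the runs `(i_{s+1} - 1, i_{s+1} - 2, …, i_s + 1)`, `s` modulo `k`; monomials of
distinct runs commute. As an element of the algebra, the monomial does not depend on the gap. -/
def hatWord {N : ℕ} (g : ZMod N) (I : Finset (ZMod N)) : List (ZMod N) :=
  ((List.range N).map fun m : ℕ => g - (m : ZMod N)).filter (fun x => x ∉ I) ++
    ((List.range N).map fun m : ℕ => g + 1 + (m : ZMod N)).filter (fun x => x ∈ I)

/-- The monomial `a(Î)`, which projects onto the configuration `I` (up to a scalar `± q`). -/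
def hatMonomial (K : Type*) [Field K] {N : ℕ} (I : Finset (ZMod N)) : Alg K N :=
  monomial K (hatWord (gap I) I)

/-- `t_k = (-1)^(k-1) ∑_{|I| = k} a(Î)`, for `1 ≤ k ≤ N - 1`. -/
def t (K : Type*) [Field K] (N : ℕ) [NeZero N] (k : ℕ) : Alg K N :=
  (-1) ^ (k - 1) * ∑ I ∈ (Finset.univ : Finset (ZMod N)).powersetCard k, hatMonomial K I

end AffineNilTL

end

/-! Nonzero monomials are controlled by how their words move particles. In a nonzero monomial both
neighbours of x occur between consecutive occurrences of x (`neighbours_mem`). Hence its word acts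
nontrivially on every configuration that suits, at each position, the first letter acting there;
`filled` is the least such configuration. If two words act nontrivially on a common configuration
and the letters of one are contained in those of the other, the smaller word splits off on the right
(`exists_split`); in particular anagrams acting on a common configuration are equal in the algebra.

The word of a(Î) has every letter once, acts only on I, and fixes I. Comparing anagrams gives a_x
a(Î) = a(Î') a_x, where x moves I to I', so the sums t_k are central. From a nonzero word with least
configuration I of size k, the word moving each particle of I once splits off on the right. The rest
acts on the shifted configuration J, and copies of a(Ĵ) split off until some letter is missing. Next
to the right-hand word all other summands of t_k vanish, so each copy becomes ± t_k
(`t_mul_rightWord`).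

A nonzero monomial missing a letter has bounded length (`length_le_of_notMem`), so finitely many
monomials span over the center. -/

noncomputable section

namespace AffineNilTL

/-! ### Consequences of the relations for monomials -/

section Words

variable {K : Type*} [Field K] {N : ℕ}

@[simp] theorem monomial_nil : monomial K ([] : List (ZMod N)) = 1 := by simp [monomial]

@[simp] theorem monomial_cons (x : ZMod N) (j : List (ZMod N)) :
    monomial K (x :: j) = gen K x * monomial K j := by simp [monomial]

@[simp] theorem monomial_append (u v : List (ZMod N)) :
    monomial K (u ++ v) = monomial K u * monomial K v := by simp [monomial]

theorem gen_mul_self (x : ZMod N) : gen K x * gen K x = 0 := by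
  have := RingQuot.mkAlgHom_rel K (Rel.sq (K := K) x)
  simpa [gen] using this

theorem gen_commute {x y : ZMod N} (h₁ : y ≠ x + 1) (h₂ : y ≠ x - 1) :
    gen K x * gen K y = gen K y * gen K x := by
  have := RingQuot.mkAlgHom_rel K (Rel.comm (K := K) x y
    (fun h => h₂ (by rw [← h]; ring)) (fun h => h₁ (by linear_combination -h)))
  simpa [gen] using this

theorem gen_braid (x : ZMod N) : gen K x * gen K (x + 1) * gen K x = 0 := by
  have := RingQuot.mkAlgHom_rel K (Rel.braid (K := K) x)
  simpa [gen] using this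

theorem gen_braid' (x : ZMod N) : gen K x * gen K (x - 1) * gen K x = 0 := by
  have := RingQuot.mkAlgHom_rel K (Rel.braid' (K := K) (x - 1))
  simpa [gen] using this

theorem gen_mul_monomial {x : ZMod N} {q : List (ZMod N)} (h₁ : x + 1 ∉ q) (h₂ : x - 1 ∉ q) :
    gen K x * monomial K q = monomial K q * gen K x := by
  induction q with
  | nil => simp
  | cons y q ih =>
    simp only [List.mem_cons, not_or] at h₁ h₂
    rw [monomial_cons, ← mul_assoc, gen_commute (Ne.symm h₁.1) (Ne.symm h₂.1), mul_assoc,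
      ih h₁.2 h₂.2, mul_assoc]

/-- Between two occurrences of a letter in a nonvanishing monomial, both neighbours occur. -/
theorem gen_mul_monomial_mul_gen_eq_zero (n : ℕ) : ∀ (q : List (ZMod N)), q.length ≤ n →
    ∀ x d : ZMod N, d = 1 ∨ d = -1 → x ∉ q → x + d ∉ q →
      gen K x * monomial K q * gen K x = 0 := by
  induction n with
  | zero =>
    intro q hq x d _ _ _
    obtain rfl : q = [] := List.length_eq_zero_iff.1 (by omega)
    simp [gen_mul_self]
  | succ n ih =>
    intro q hq x d hd hx hxd
    have key : ∀ r : List (ZMod N), x + d ∉ r → x - d ∉ r →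
        gen K x * monomial K r = monomial K r * gen K x := by
      rcases hd with rfl | rfl
      · exact fun r h₁ h₂ => gen_mul_monomial h₁ h₂
      · exact fun r h₁ h₂ => gen_mul_monomial (by simpa using h₂) (by simpa [sub_eq_add_neg] using h₁)
    have braid : gen K x * gen K (x - d) * gen K x = 0 := by
      rcases hd with rfl | rfl
      · exact gen_braid' x
      · simpa using gen_braid (K := K) x
    by_cases h : x - d ∈ q
    · obtain ⟨q₁, q₂, rfl, h₁⟩ := List.eq_append_cons_of_mem h
      simp only [List.mem_append, List.mem_cons, not_or] at hx hxd
      by_cases h' : x - d ∈ q₂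
      · obtain ⟨q₃, q₄, rfl, h₃⟩ := List.eq_append_cons_of_mem h'
        simp only [List.mem_append, List.mem_cons, not_or] at hx hxd
        -- Between two consecutive occurrences of `x - d` its neighbour `(x - d) + d = x` is
        -- missing, so the shorter word `q₃` already forces zero.
        have := ih q₃ (by simp at hq; omega) (x - d) d hd h₃ (by simpa using hx.2.2.1)
        have e : gen K x * monomial K (q₁ ++ (x - d) :: (q₃ ++ (x - d) :: q₄)) * gen K x =
            gen K x * monomial K q₁ * (gen K (x - d) * monomial K q₃ * gen K (x - d)) *
              monomial K q₄ * gen K x := by simp [mul_assoc]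
        rw [e, this]; simp
      · have e : gen K x * monomial K (q₁ ++ (x - d) :: q₂) * gen K x =
            (gen K x * monomial K q₁) * gen K (x - d) * (monomial K q₂ * gen K x) := by
          simp [mul_assoc]
        rw [e, key _ hxd.1 h₁, ← key _ hxd.2.2 h']
        have e' : monomial K q₁ * gen K x * gen K (x - d) * (gen K x * monomial K q₂) =
            monomial K q₁ * (gen K x * gen K (x - d) * gen K x) * monomial K q₂ := by
          simp [mul_assoc]
        rw [e', braid]; simp
    · rw [key q hxd h, mul_assoc, gen_mul_self, mul_zero]

theorem neighbours_mem {x : ZMod N} {q r : List (ZMod N)}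
    (h : monomial K (x :: (q ++ x :: r)) ≠ 0) (hx : x ∉ q) : x + 1 ∈ q ∧ x - 1 ∈ q := by
  have e : monomial K (x :: (q ++ x :: r)) =
      gen K x * monomial K q * gen K x * monomial K r := by simp [mul_assoc]
  rw [e] at h
  constructor <;> by_contra hc
  · exact h (by rw [gen_mul_monomial_mul_gen_eq_zero _ q le_rfl x 1 (.inl rfl) hx hc, zero_mul])
  · exact h (by rw [gen_mul_monomial_mul_gen_eq_zero _ q le_rfl x (-1) (.inr rfl) hx
      (by simpa [sub_eq_add_neg] using hc), zero_mul])

end Words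

/-! ### Particle motion and the least configuration -/

section Action

variable {N : ℕ}

@[simp] theorem act_nil (S : Finset (ZMod N)) : act [] S = some S := rfl

theorem act_cons_eq_some {x : ZMod N} {j : List (ZMod N)} {S T : Finset (ZMod N)} :
    act (x :: j) S = some T ↔
      ∃ U, act j S = some U ∧ x ∈ U ∧ x + 1 ∉ U ∧ T = insert (x + 1) (U.erase x) := by
  simp only [act, Option.bind_eq_some_iff]
  refine exists_congr fun U => and_congr_right fun _ => ?_
  split_ifs with h
  · simp [h, eq_comm]
  · simp only [false_iff]; tauto

theorem act_append (u v : List (ZMod N)) (S : Finset (ZMod N)) :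
    act (u ++ v) S = (act v S).bind (act u) := by
  induction u with
  | nil => simp [act, Option.bind_fun_some]
  | cons x u ih => simp [act, ih, Option.bind_assoc]

theorem act_append_eq_some {u v : List (ZMod N)} {S T : Finset (ZMod N)} :
    act (u ++ v) S = some T ↔ ∃ U, act v S = some U ∧ act u U = some T := by
  rw [act_append, Option.bind_eq_some_iff]

theorem act_singleton_eq_some {x : ZMod N} {S T : Finset (ZMod N)} :
    act [x] S = some T ↔ x ∈ S ∧ x + 1 ∉ S ∧ T = insert (x + 1) (S.erase x) := by
  simp [act_cons_eq_some]

/-- Only the letters `x` and `x - 1` change the occupation of `x`. -/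
theorem mem_act_iff_of_notMem {x : ZMod N} : ∀ {j : List (ZMod N)} {S T : Finset (ZMod N)},
    act j S = some T → x ∉ j → x - 1 ∉ j → (x ∈ T ↔ x ∈ S)
  | [], S, T, h, _, _ => by simp at h; rw [h]
  | y :: j, S, T, h, h₁, h₂ => by
    obtain ⟨U, hU, _, _, rfl⟩ := act_cons_eq_some.1 h
    simp only [List.mem_cons, not_or] at h₁ h₂
    have : x ≠ y + 1 := fun e => h₂.1 (by rw [e]; ring)
    simp [this, h₁.1, mem_act_iff_of_notMem hU h₁.2 h₂.2]

/-- The positions that have to be occupied for the word `j` to act nontrivially. -/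
def filled : List (ZMod N) → Finset (ZMod N)
  | [] => ∅
  | x :: j => if x ∈ j ∨ x - 1 ∈ j then filled j else insert x (filled j)

/-- The positions that have to be empty for the word `j` to act nontrivially. -/
def emptied : List (ZMod N) → Finset (ZMod N)
  | [] => ∅
  | x :: j => if x ∈ j ∨ x + 1 ∈ j then emptied j else insert (x + 1) (emptied j)

theorem mem_of_mem_filled {x : ZMod N} : ∀ {j : List (ZMod N)}, x ∈ filled j → x ∈ j
  | [], h => by simp [filled] at h
  | y :: j, h => by
    rw [filled] at h
    split_ifs at h
    · exact List.mem_cons_of_mem _ (mem_of_mem_filled h)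
    · rcases Finset.mem_insert.1 h with rfl | h
      · simp
      · exact List.mem_cons_of_mem _ (mem_of_mem_filled h)

theorem mem_of_mem_emptied {x : ZMod N} : ∀ {j : List (ZMod N)}, x ∈ emptied j → x - 1 ∈ j
  | [], h => by simp [emptied] at h
  | y :: j, h => by
    rw [emptied] at h
    split_ifs at h
    · exact List.mem_cons_of_mem _ (mem_of_mem_emptied h)
    · rcases Finset.mem_insert.1 h with rfl | h
      · simp
      · exact List.mem_cons_of_mem _ (mem_of_mem_emptied h)

theorem filled_subset : ∀ {j : List (ZMod N)} {S T : Finset (ZMod N)}, act j S = some T →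
    filled j ⊆ S
  | [], _, _, _ => by simp [filled]
  | y :: j, S, T, h => by
    obtain ⟨U, hU, hy, _, rfl⟩ := act_cons_eq_some.1 h
    rw [filled]
    split_ifs with hj
    · exact filled_subset hU
    · push Not at hj
      exact Finset.insert_subset ((mem_act_iff_of_notMem hU hj.1 hj.2).1 hy) (filled_subset hU)

theorem emptied_disjoint : ∀ {j : List (ZMod N)} {S T : Finset (ZMod N)}, act j S = some T →
    ∀ x ∈ emptied j, x ∉ S
  | [], _, _, _ => by simp [emptied]
  | y :: j, S, T, h => by
    obtain ⟨U, hU, _, hy, rfl⟩ := act_cons_eq_some.1 h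
    rw [emptied]
    split_ifs with hj
    · exact emptied_disjoint hU
    · push Not at hj
      intro x hx
      rcases Finset.mem_insert.1 hx with rfl | hx
      · exact fun hS => hy ((mem_act_iff_of_notMem hU hj.2 (by simpa using hj.1)).2 hS)
      · exact emptied_disjoint hU x hx

/-- The first letter to act at `x` decides: the letter `x` needs a particle there, the letter `x -
1` needs a vacancy. -/
theorem mem_filled_or_mem_emptied {x : ZMod N} : ∀ {j : List (ZMod N)}, x ∈ j ∨ x - 1 ∈ j →
    x ∈ filled j ∨ x ∈ emptied j
  | [], h => by simp at h
  | y :: j, h => by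
    by_cases h' : x ∈ j ∨ x - 1 ∈ j
    · refine (mem_filled_or_mem_emptied h').imp (fun h => ?_) (fun h => ?_)
      · rw [filled]; split_ifs <;> simp [h]
      · rw [emptied]; split_ifs <;> simp [h]
    · simp only [List.mem_cons] at h
      rcases h with (rfl | h) | (h | h)
      · left; rw [filled, if_neg h']; simp
      · exact absurd (.inl h) h'
      · right
        obtain rfl : x = y + 1 := by rw [← h]; ring
        rw [emptied, if_neg (by simpa [or_comm] using h')]; simp
      · exact absurd (.inr h) h'

/-- A word in which every letter occurs acts nontrivially on at most one configuration. -/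
theorem eq_filled_of_act {j : List (ZMod N)} {S T : Finset (ZMod N)} (hj : ∀ x, x ∈ j)
    (h : act j S = some T) : S = filled j := by
  refine Finset.Subset.antisymm (fun x hx => ?_) (filled_subset h)
  exact (mem_filled_or_mem_emptied (.inl (hj x))).resolve_right
    fun hx' => emptied_disjoint h x hx' hx

theorem eq_of_act {j : List (ZMod N)} {S S' T T' : Finset (ZMod N)} (hj : ∀ x, x ∈ j)
    (h : act j S = some T) (h' : act j S' = some T') : S = S' :=
  (eq_filled_of_act hj h).trans (eq_filled_of_act hj h').symm

/-- A letter `x - 1` in `q` fills `x`, and nothing in `q` acting later can empty it. -/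
theorem mem_act_of_pred_mem {x : ZMod N} {r : List (ZMod N)} :
    ∀ {q : List (ZMod N)} {S T : Finset (ZMod N)}, act (q ++ r) S = some T → x ∉ q →
      x - 1 ∈ q → x ∈ T
  | [], _, _, _, _, h => by simp at h
  | y :: q, S, T, h, h₁, h₂ => by
    obtain ⟨U, hU, _, _, rfl⟩ := act_cons_eq_some.1 h
    simp only [List.mem_cons, not_or] at h₁ h₂
    rcases h₂ with h₂ | h₂
    · simp [← h₂]
    · simp [h₁.1, mem_act_of_pred_mem hU h₁.2 h₂]

theorem insert_succ_erase_comm {x y : ZMod N} {S : Finset (ZMod N)} (h₁ : y ≠ x + 1)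
    (h₂ : y + 1 ≠ x) :
    insert (x + 1) ((insert (y + 1) (S.erase y)).erase x) =
      insert (y + 1) ((insert (x + 1) (S.erase x)).erase y) := by
  ext z
  simp only [Finset.mem_insert, Finset.mem_erase]
  grind

variable [Fact (1 < N)]

theorem filled_disjoint_emptied {x : ZMod N} : ∀ {j : List (ZMod N)}, x ∈ filled j →
    x ∉ emptied j
  | [] => by simp [filled]
  | y :: j => by
    have ih := @filled_disjoint_emptied x j
    have h₁ := @mem_of_mem_filled N x j
    have h₂ := @mem_of_mem_emptied N x j
    rw [filled, emptied]
    split_ifs with h h' h'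
    · exact ih
    · simp only [Finset.mem_insert]
      rintro hx (rfl | hx')
      · exact h' (.inr (h₁ hx))
      · exact ih hx hx'
    · simp only [Finset.mem_insert]
      rintro (rfl | hx) hx'
      · exact h (.inr (h₂ hx'))
      · exact ih hx hx'
    · simp only [Finset.mem_insert]
      rintro (rfl | hx) (hx' | hx')
      · simp at hx'
      · exact h (.inr (h₂ hx'))
      · subst hx'; exact h' (.inr (h₁ hx))
      · exact ih hx hx'

theorem notMem_act_of_mem {x : ZMod N} {r : List (ZMod N)} :
    ∀ {q : List (ZMod N)} {S T : Finset (ZMod N)}, act (q ++ r) S = some T → x ∈ q →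
      x - 1 ∉ q → x ∉ T
  | [], _, _, _, h, _ => by simp at h
  | y :: q, S, T, h, h₁, h₂ => by
    obtain ⟨U, hU, _, _, rfl⟩ := act_cons_eq_some.1 h
    simp only [List.mem_cons, not_or] at h₁ h₂
    have hne : x ≠ y + 1 := fun e => h₂.1 (by rw [e]; ring)
    rcases h₁ with rfl | h₁
    · simp
    · simp [hne, notMem_act_of_mem hU h₁ h₂.2]

/-- A nonvanishing monomial acts nontrivially as soon as its constraints on the configuration
are met. -/
theorem exists_act_of_monomial_ne_zero {K : Type*} [Field K] :
    ∀ {j : List (ZMod N)} {S : Finset (ZMod N)}, monomial K j ≠ 0 → filled j ⊆ S →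
      (∀ x ∈ emptied j, x ∉ S) → ∃ T, act j S = some T
  | [], S, _, _, _ => ⟨S, rfl⟩
  | y :: j, S, h, hf, he => by
    have hf' : filled j ⊆ S := by
      rw [filled] at hf; split_ifs at hf
      · exact hf
      · exact (Finset.subset_insert _ _).trans hf
    have he' : ∀ x ∈ emptied j, x ∉ S := by
      rw [emptied] at he; split_ifs at he
      · exact he
      · exact fun x hx => he x (Finset.mem_insert_of_mem hx)
    obtain ⟨U, hU⟩ := exists_act_of_monomial_ne_zero (K := K)
      (fun h0 => h (by rw [monomial_cons, h0, mul_zero])) hf' he'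
    have hy : y ∈ U ∧ y + 1 ∉ U := by
      -- If `y` recurs, then since its previous action `y - 1` has refilled `y` and `y + 1` has
      -- vacated `y + 1`. Otherwise each position is settled either by that neighbour or, if
      -- untouched so far, by the constraint on `S`.
      by_cases hyj : y ∈ j
      · obtain ⟨q, r, rfl, hq⟩ := List.eq_append_cons_of_mem hyj
        obtain ⟨h₁, h₂⟩ := neighbours_mem h hq
        exact ⟨mem_act_of_pred_mem hU hq h₂, notMem_act_of_mem hU h₁ (by simpa using hq)⟩
      · have hU' : act (j ++ []) S = some U := by simpa using hU
        constructor
        · by_cases h' : y - 1 ∈ j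
          · exact mem_act_of_pred_mem hU' hyj h'
          · rw [mem_act_iff_of_notMem hU hyj h']
            apply hf; rw [filled, if_neg (by tauto)]; simp
        · by_cases h' : y + 1 ∈ j
          · exact notMem_act_of_mem hU' h' (by simpa using hyj)
          · rw [mem_act_iff_of_notMem hU h' (by simpa using hyj)]
            apply he; rw [emptied, if_neg (by tauto)]; simp
    exact ⟨_, act_cons_eq_some.2 ⟨U, hU, hy.1, hy.2, rfl⟩⟩

theorem exists_act_filled {K : Type*} [Field K] {j : List (ZMod N)} (h : monomial K j ≠ 0) :
    ∃ T, act j (filled j) = some T :=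
  exists_act_of_monomial_ne_zero h subset_rfl fun _ hx hx' => filled_disjoint_emptied hx' hx

theorem isLeast_filled {K : Type*} [Field K] {j : List (ZMod N)} (h : monomial K j ≠ 0) :
    IsLeast (support j) (filled j) := by
  obtain ⟨T, hT⟩ := exists_act_filled h
  refine ⟨by simp [support, hT], fun S hS => ?_⟩
  obtain ⟨U, hU⟩ := Option.ne_none_iff_exists'.1 hS
  exact filled_subset hU

end Action

/-! ### Splitting a word off on the right -/

section Extraction

variable {K : Type*} [Field K] {N : ℕ}

/-- A letter acting nontrivially on `S` can be moved to the right end, past letters different from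
it, in any word acting nontrivially on `S`. -/
theorem act_move_right {x : ZMod N} {S : Finset (ZMod N)} (hx : x ∈ S) (hx' : x + 1 ∉ S) :
    ∀ {q : List (ZMod N)} {U : Finset (ZMod N)}, act q S = some U → x ∉ q →
      x + 1 ∉ q ∧ x - 1 ∉ q ∧ x ∈ U ∧ x + 1 ∉ U ∧
        act (q ++ [x]) S = some (insert (x + 1) (U.erase x))
  | [], U, h, _ => by
    simp only [act_nil, Option.some.injEq] at h
    subst h
    simp [hx, hx', act_singleton_eq_some]
  | y :: q, U, h, hq => by
    obtain ⟨V, hV, hy, hy', rfl⟩ := act_cons_eq_some.1 h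
    simp only [List.mem_cons, not_or] at hq
    obtain ⟨h₁, h₂, h₃, h₄, h₅⟩ := act_move_right hx hx' hV hq.2
    -- The particle at `x` and the vacancy at `x + 1` persist, so neither neighbour of `x` can act.
    have n₁ : x + 1 ≠ y := fun e => h₄ (e ▸ hy)
    have n₂ : x ≠ y + 1 := fun e => hy' (e ▸ h₃)
    have n₃ : x - 1 ≠ y := fun e => n₂ (by rw [← e]; ring)
    refine ⟨by simp [n₁, h₁], by simp [n₃, h₂], by simp [hq.1, h₃], ?_, ?_⟩
    · simp [h₄, hq.1]
    · rw [insert_succ_erase_comm n₁.symm n₂.symm, List.cons_append,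
        act_cons_eq_some]
      refine ⟨_, h₅, ?_, ?_, rfl⟩
      · simp [Ne.symm hq.1, hy]
      · simp [hy', Ne.symm hq.1]

/-- If the words `v` and `j` act nontrivially on the same configuration and `j` has all the letters
of `v`, with multiplicities, then `v` splits off at the right of `j`. -/
theorem exists_split (v : List (ZMod N)) : ∀ {j : List (ZMod N)} {S T T' : Finset (ZMod N)},
    act j S = some T → act v S = some T' → (v : Multiset (ZMod N)) ≤ j →
      ∃ u, monomial K j = monomial K (u ++ v) ∧ j.Perm (u ++ v) ∧ act u T' = some T := by
  induction v using List.reverseRecOn with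
  | nil =>
    intro j S T T' h h' _
    simp only [act_nil, Option.some.injEq] at h'
    subst h'
    exact ⟨j, by simp, by simp, h⟩
  | append_singleton v x ih =>
    intro j S T T' h h' hle
    obtain ⟨S₁, hS₁, hv⟩ := act_append_eq_some.1 h'
    obtain ⟨hx, hx', rfl⟩ := act_singleton_eq_some.1 hS₁
    have hxj : x ∈ j := by
      have := Multiset.mem_of_le hle (a := x) (by simp)
      simpa using this
    -- Reversal picks the rightmost occurrence of `x` in `j`, the one acting first.
    obtain ⟨q, p, hj, hq⟩ := List.eq_append_cons_of_mem (List.mem_reverse.2 hxj)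
    obtain ⟨q, rfl⟩ := List.reverse_surjective q
    obtain ⟨p, rfl⟩ := List.reverse_surjective p
    obtain rfl : j = p ++ x :: q := by
      rw [← List.reverse_inj, hj]; simp
    rw [List.mem_reverse] at hq
    obtain ⟨U, hU, hp⟩ := act_append_eq_some.1 h
    obtain ⟨V, hV, -, -, rfl⟩ := act_cons_eq_some.1 hU
    obtain ⟨h₁, h₂, h₃, h₄, h₅⟩ := act_move_right hx hx' hV hq
    obtain ⟨S₂, hS₂, hq'⟩ := act_append_eq_some.1 h₅
    obtain rfl := Option.some.inj (hS₁.symm.trans hS₂)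
    have hperm : (p ++ x :: q).Perm ((p ++ q) ++ [x]) := by
      rw [List.append_assoc]
      exact (List.perm_append_singleton x q).symm.append_left p
    have hle' : (v : Multiset (ZMod N)) ≤ ((p ++ q : List (ZMod N)) : Multiset (ZMod N)) := by
      rw [Multiset.coe_eq_coe.2 hperm] at hle
      simpa only [← Multiset.coe_add, add_le_add_iff_right] using hle
    obtain ⟨u, hu₁, hu₂, hu₃⟩ := ih (act_append_eq_some.2 ⟨_, hq', hp⟩) hv hle'
    refine ⟨u, ?_, ?_, hu₃⟩
    · rw [← List.append_assoc, monomial_append (u ++ v), ← hu₁]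
      simp [gen_mul_monomial h₁ h₂, mul_assoc]
    · rw [← List.append_assoc]
      exact hperm.trans (hu₂.append_right _)

theorem monomial_eq_of_perm {u v : List (ZMod N)} {S T T' : Finset (ZMod N)}
    (h : u.Perm v) (hu : act u S = some T) (hv : act v S = some T') :
    monomial K u = monomial K v := by
  obtain ⟨w, h₁, h₂, -⟩ := exists_split (K := K) v hu hv (by rw [Multiset.coe_eq_coe.2 h])
  have : w = [] := by
    have := (h.symm.trans h₂).length_eq
    rw [List.length_append] at this
    exact List.length_eq_zero_iff.1 (by omega)
  simpa [this] using h₁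

end Extraction

/-! ### The words of a(Î) and their action -/

section HatWord

variable {N : ℕ}

/-- The right part of `hatWord g I`: the positions in `I`, in the cyclic order ending at `g`. -/
def rightWord (g : ZMod N) (I : Finset (ZMod N)) : List (ZMod N) :=
  ((List.range N).map fun m : ℕ => g + 1 + (m : ZMod N)).filter (fun x => x ∈ I)

/-- The left part of `hatWord g I`: the positions outside `I`, in decreasing cyclic order from
`g`. -/
def leftWord (g : ZMod N) (I : Finset (ZMod N)) : List (ZMod N) :=
  ((List.range N).map fun m : ℕ => g - (m : ZMod N)).filter (fun x => x ∉ I)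

theorem hatWord_eq (g : ZMod N) (I : Finset (ZMod N)) :
    hatWord g I = leftWord g I ++ rightWord g I := rfl

theorem gap_spec [NeZero N] {I : Finset (ZMod N)} (h₀ : I.Nonempty) (h₁ : I ≠ Finset.univ) :
    gap I ∈ I ∧ gap I + 1 ∉ I := by
  apply Classical.epsilon_spec (p := fun g => g ∈ I ∧ g + 1 ∉ I)
  by_contra hc
  push Not at hc
  obtain ⟨a, ha⟩ := h₀
  have key : ∀ m : ℕ, a + m ∈ I := by
    intro m
    induction m with
    | zero => simpa using ha
    | succ m ih => simpa [add_assoc] using hc _ ih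
  refine h₁ (Finset.eq_univ_of_forall fun b => ?_)
  simpa using key (b - a).val

variable [NeZero N]

theorem mem_rightWord {g x : ZMod N} {I : Finset (ZMod N)} : x ∈ rightWord g I ↔ x ∈ I := by
  simp only [rightWord, List.mem_filter, List.mem_map, List.mem_range, decide_eq_true_eq,
    and_iff_right_iff_imp]
  exact fun _ => ⟨(x - (g + 1)).val, ZMod.val_lt _, by simp⟩

theorem mem_leftWord {g x : ZMod N} {I : Finset (ZMod N)} : x ∈ leftWord g I ↔ x ∉ I := by
  simp only [leftWord, List.mem_filter, List.mem_map, List.mem_range, decide_eq_true_eq,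
    and_iff_right_iff_imp]
  exact fun _ => ⟨(g - x).val, ZMod.val_lt _, by simp⟩

theorem mem_hatWord (g x : ZMod N) (I : Finset (ZMod N)) : x ∈ hatWord g I := by
  rw [hatWord_eq, List.mem_append, mem_rightWord, mem_leftWord]
  exact (em _).symm

/-- The letters of `hatWord g I` are in increasing order with respect to this rank. -/
def hatRank (g : ZMod N) (I : Finset (ZMod N)) (x : ZMod N) : ℤ :=
  if x ∈ I then ((x - (g + 1)).val : ℤ) else -((x - (g + 1)).val : ℤ) - 1

theorem hatWord_pairwise (g : ZMod N) (I : Finset (ZMod N)) :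
    (hatWord g I).Pairwise fun x y => hatRank g I x < hatRank g I y := by
  rw [hatWord_eq, List.pairwise_append]
  refine ⟨?_, ?_, fun x hx y hy => ?_⟩
  · rw [leftWord, List.pairwise_filter, List.pairwise_map]
    refine List.pairwise_lt_range.imp_of_mem fun {a b} ha hb hab h₁ h₂ => ?_
    simp only [decide_eq_true_eq] at h₁ h₂
    rw [List.mem_range] at ha hb
    -- Entry `c` of the left list lies `N - 1 - c` steps after `g + 1`; the minus sign in `hatRank`
    -- turns this decreasing sequence into an increasing one.
    have key : ∀ c < N, (g - (c : ZMod N) - (g + 1)).val = N - 1 - c := by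
      intro c hc
      have : g - (c : ZMod N) - (g + 1) = ((N - 1 - c : ℕ) : ZMod N) := by
        rw [Nat.cast_sub (by omega), Nat.cast_sub (by omega)]
        simp only [Nat.cast_one, CharP.cast_eq_zero]
        ring
      rw [this, ZMod.val_natCast_of_lt (by omega)]
    rw [hatRank, hatRank, if_neg h₁, if_neg h₂, key a ha, key b hb]
    omega
  · rw [rightWord, List.pairwise_filter, List.pairwise_map]
    refine List.pairwise_lt_range.imp_of_mem fun {a b} ha hb hab h₁ h₂ => ?_
    simp only [decide_eq_true_eq] at h₁ h₂
    rw [List.mem_range] at ha hb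
    rw [hatRank, hatRank, if_pos h₁, if_pos h₂, add_sub_cancel_left, add_sub_cancel_left,
      ZMod.val_natCast_of_lt ha, ZMod.val_natCast_of_lt hb]
    exact_mod_cast hab
  -- The summand `-1` in `hatRank` keeps the left part strictly negative, below the right part.
  · rw [hatRank, hatRank, if_neg (mem_leftWord.1 hx), if_pos (mem_rightWord.1 hy)]
    omega

theorem hatWord_nodup (g : ZMod N) (I : Finset (ZMod N)) : (hatWord g I).Nodup :=
  (hatWord_pairwise g I).imp fun h e => by simp [e] at h

theorem rightWord_nodup (g : ZMod N) (I : Finset (ZMod N)) : (rightWord g I).Nodup :=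
  (List.nodup_append.1 (hatWord_eq g I ▸ hatWord_nodup g I)).2.1

theorem toFinset_rightWord (g : ZMod N) (I : Finset (ZMod N)) : (rightWord g I).toFinset = I := by
  ext x; simp [mem_rightWord]

theorem length_rightWord (g : ZMod N) (I : Finset (ZMod N)) :
    (rightWord g I).length = I.card := by
  rw [← List.toFinset_card_of_nodup (rightWord_nodup g I), toFinset_rightWord]

theorem mem_suffix_hatWord {g x : ZMod N} {I : Finset (ZMod N)} {p w : List (ZMod N)}
    (h : hatWord g I = p ++ x :: w) (y : ZMod N) : y ∈ w ↔ hatRank g I x < hatRank g I y := by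
  have hp := hatWord_pairwise g I
  have hy := mem_hatWord g y I
  rw [h] at hp hy
  obtain ⟨-, hxw, hpx⟩ := List.pairwise_append.1 hp
  refine ⟨fun hw => List.rel_of_pairwise_cons hxw hw, fun hlt => ?_⟩
  rcases List.mem_append.1 hy with hy | hy
  · exact absurd (hpx y hy x (by simp)) hlt.not_gt
  · rcases List.mem_cons.1 hy with rfl | hy
    · exact absurd hlt (lt_irrefl _)
    · exact hy

theorem val_add_one_of_ne {z : ZMod N} (h : z + 1 ≠ 0) : (z + 1).val = z.val + 1 := by
  have hz := ZMod.val_lt z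
  have hne : z.val + 1 ≠ N := fun e => h <| by
    have := congrArg (Nat.cast : ℕ → ZMod N) e
    simpa using this
  have : z + 1 = ((z.val + 1 : ℕ) : ZMod N) := by simp
  rw [this, ZMod.val_natCast_of_lt (by omega)]

/-- Away from `g`, passing to the successor raises the distance from `g + 1` by one; the wrap-around
at `g` is where the gap condition enters. -/
theorem hatRank_succ {g : ZMod N} {I : Finset (ZMod N)} (hg : g ∈ I) (hg' : g + 1 ∉ I)
    (x : ZMod N) :
    (x + 1 ∈ I → hatRank g I x < hatRank g I (x + 1)) ∧
      (x + 1 ∉ I → hatRank g I (x + 1) < hatRank g I x) := by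
  by_cases hx : x = g
  · subst hx
    refine ⟨fun h => absurd h hg', fun h => ?_⟩
    rw [hatRank, hatRank, if_pos hg, if_neg h]; omega
  · have e : (x + 1 - (g + 1)).val = (x - (g + 1)).val + 1 := by
      have : x + 1 - (g + 1) = x - (g + 1) + 1 := by ring
      rw [this, val_add_one_of_ne]
      intro h; apply hx; linear_combination h
    unfold hatRank
    refine ⟨fun h => ?_, fun h => ?_⟩ <;> simp only [h, if_true, if_false] <;>
      split_ifs <;> omega

theorem hatWord_order {g : ZMod N} {I : Finset (ZMod N)} (hg : g ∈ I) (hg' : g + 1 ∉ I)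
    (p : List (ZMod N)) (x : ZMod N) (w : List (ZMod N)) (h : hatWord g I = p ++ x :: w) :
    x ∉ w ∧ (x ∈ I ↔ x - 1 ∉ w) ∧ (x + 1 ∈ I ↔ x + 1 ∈ w) := by
  have h₁ := hatRank_succ hg hg' x
  have h₂ := hatRank_succ hg hg' (x - 1)
  rw [sub_add_cancel] at h₂
  simp only [mem_suffix_hatWord h]
  refine ⟨lt_irrefl _, ⟨fun hx => (h₂.1 hx).not_gt, fun hlt => ?_⟩, h₁.1, fun hlt => ?_⟩
  · by_contra hx; exact hlt (h₂.2 hx)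
  · by_contra hx; exact hlt.not_gt (h₁.2 hx)

variable [Fact (1 < N)]

-- When `x` acts, `x` is occupied either from the start or because `x - 1` has acted, and `x + 1` is
-- empty either from the start or because `x + 1` has acted. The order condition passes to suffixes,
-- so it serves both `hatWord` and `rightWord`.
omit [NeZero N] in
theorem act_of_order {I : Finset (ZMod N)} : ∀ {v : List (ZMod N)},
    (∀ p x w, v = p ++ x :: w → x ∉ w ∧ (x ∈ I ↔ x - 1 ∉ w) ∧ (x + 1 ∈ I ↔ x + 1 ∈ w)) →
    ∃ T, act v I = some T ∧
      ∀ y, y ∈ T ↔ (y ∈ I ∧ (y ∉ v ∨ y - 1 ∈ v)) ∨ (y ∉ I ∧ y - 1 ∈ v ∧ y ∉ v)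
  | [], _ => ⟨I, rfl, by simp⟩
  | x :: w, h => by
    obtain ⟨U, hU, hmem⟩ := act_of_order (I := I) (v := w) fun p z r e =>
      h (x :: p) z r (by rw [e]; rfl)
    obtain ⟨h₁, h₂, h₃⟩ := h [] x w rfl
    have hx : x ∈ U := by rw [hmem]; tauto
    have hx' : x + 1 ∉ U := by
      rw [hmem, add_sub_cancel_right]; tauto
    refine ⟨_, act_cons_eq_some.2 ⟨U, hU, hx, hx', rfl⟩, fun y => ?_⟩
    have n₁ : x + 1 ≠ x := by simp
    have n₂ : x - 1 ≠ x := by simp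
    rw [Finset.mem_insert, Finset.mem_erase, hmem]
    by_cases e₁ : y = x
    · subst e₁
      simp only [List.mem_cons, n₂, hmem] at hx ⊢
      by_cases hy : y ∈ I <;> simp [hy] at h₂ ⊢
      exact h₂
    · by_cases e₂ : y = x + 1
      · subst e₂
        by_cases hy : x + 1 ∈ I <;> simp [hy] at h₃ ⊢
        exact h₃
      · have e₃ : y - 1 ≠ x := fun e => e₂ (by rw [← e]; ring)
        simp [e₁, e₂, e₃]

theorem act_hatWord {g : ZMod N} {I : Finset (ZMod N)} (hg : g ∈ I) (hg' : g + 1 ∉ I) :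
    act (hatWord g I) I = some I := by
  obtain ⟨T, hT, hmem⟩ := act_of_order (hatWord_order hg hg')
  rw [hT]
  congr 1
  ext y
  simp [hmem, mem_hatWord]

/-- The configuration in which every particle of `I` has moved one step. -/
def shift (I : Finset (ZMod N)) : Finset (ZMod N) := I.image (· + 1)

omit [NeZero N] [Fact (1 < N)] in
theorem mem_shift {x : ZMod N} {I : Finset (ZMod N)} : x ∈ shift I ↔ x - 1 ∈ I := by
  simp only [shift, Finset.mem_image]
  exact ⟨by rintro ⟨y, hy, rfl⟩; simpa using hy, fun h => ⟨_, h, by simp⟩⟩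

theorem act_rightWord {g : ZMod N} {I : Finset (ZMod N)} (hg : g ∈ I) (hg' : g + 1 ∉ I) :
    act (rightWord g I) I = some (shift I) := by
  obtain ⟨T, hT, hmem⟩ := act_of_order (v := rightWord g I) fun p x w h =>
    hatWord_order hg hg' (leftWord g I ++ p) x w (by rw [hatWord_eq, h, List.append_assoc])
  rw [hT]
  congr 1
  ext y
  simp only [hmem, mem_rightWord, mem_shift]
  tauto

end HatWord

/-! ### Centrality of the elements t_k -/

section Center

variable {K : Type*} [Field K] {N : ℕ}

theorem adjoin_range_gen : Algebra.adjoin K (Set.range (gen K (N := N))) = ⊤ := by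
  have h : Set.range (gen K (N := N)) =
      RingQuot.mkAlgHom K (Rel K N) '' Set.range (FreeAlgebra.ι K) := by
    rw [← Set.range_comp]; rfl
  rw [h, ← AlgHom.map_adjoin, FreeAlgebra.adjoin_range_ι, Algebra.map_top,
    AlgHom.range_eq_top]
  exact RingQuot.mkAlgHom_surjective K _

theorem span_range_monomial : Submodule.span K (Set.range (monomial K (N := N))) = ⊤ := by
  rw [eq_top_iff, ← Algebra.top_toSubmodule, ← adjoin_range_gen, Algebra.adjoin_eq_span]
  refine Submodule.span_mono fun a ha => ?_
  obtain ⟨l, hl, rfl⟩ := Submonoid.exists_list_of_mem_closure ha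
  choose! f hf using hl
  refine ⟨l.map f, ?_⟩
  rw [monomial, List.map_map]
  congr 1
  exact (List.map_congr_left hf).trans (List.map_id l)

theorem mem_center_of_commute_gen {a : Alg K N} (h : ∀ x, gen K x * a = a * gen K x) :
    a ∈ Subalgebra.center K (Alg K N) := by
  rw [Subalgebra.mem_center_iff]
  intro b
  have hle : Algebra.adjoin K (Set.range (gen K (N := N))) ≤ Subalgebra.centralizer K {a} := by
    refine Algebra.adjoin_le ?_
    rintro _ ⟨x, rfl⟩
    simp only [SetLike.mem_coe, Subalgebra.mem_centralizer_iff, Set.mem_singleton_iff, forall_eq]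
    exact (h x).symm
  have hb : b ∈ Algebra.adjoin K (Set.range (gen K (N := N))) := by
    rw [adjoin_range_gen]; trivial
  exact ((Subalgebra.mem_centralizer_iff K).1 (hle hb) a rfl).symm

theorem neg_one_pow_mem_center (m : ℕ) : (-1 : Alg K N) ^ m ∈ Subalgebra.center K (Alg K N) :=
  pow_mem (neg_mem (one_mem _)) m

theorem neg_one_pow_commute (m : ℕ) (a : Alg K N) : Commute ((-1) ^ m) a :=
  (Subalgebra.mem_center_iff.1 (neg_one_pow_mem_center m) a).symm

theorem neg_one_pow_mul_self (m : ℕ) : (-1 : Alg K N) ^ m * (-1) ^ m = 1 := by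
  rw [← pow_add]
  exact Even.neg_one_pow (α := Alg K N) ⟨m, rfl⟩

theorem card_act [Fact (1 < N)] : ∀ {j : List (ZMod N)} {S T : Finset (ZMod N)},
    act j S = some T → T.card = S.card
  | [], S, T, h => by simp at h; rw [h]
  | y :: j, S, T, h => by
    obtain ⟨U, hU, hy, hy', rfl⟩ := act_cons_eq_some.1 h
    rw [Finset.card_insert_of_notMem (by simp [hy']), Finset.card_erase_add_one hy, card_act hU]

variable [NeZero N]

theorem ne_univ_of_card_le {I : Finset (ZMod N)} (h : I.card ≤ N - 1) : I ≠ Finset.univ := by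
  rintro rfl
  rw [Finset.card_univ, ZMod.card] at h
  have := NeZero.ne N
  omega

variable [Fact (1 < N)]

theorem act_hatWord_gap {I : Finset (ZMod N)} (h₀ : I.Nonempty) (h₁ : I ≠ Finset.univ) :
    act (hatWord (gap I) I) I = some I :=
  act_hatWord (gap_spec h₀ h₁).1 (gap_spec h₀ h₁).2

theorem eq_of_act_hatWord {I S T : Finset (ZMod N)} (h₀ : I.Nonempty) (h₁ : I ≠ Finset.univ)
    (h : act (hatWord (gap I) I) S = some T) : S = I ∧ T = I := by
  obtain rfl := eq_of_act (mem_hatWord _ · _) h (act_hatWord_gap h₀ h₁)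
  exact ⟨rfl, Option.some.inj (h.symm.trans (act_hatWord_gap h₀ h₁))⟩

theorem of_gen_mul_hatMonomial_ne_zero {I : Finset (ZMod N)} {x : ZMod N} (h₀ : I.Nonempty)
    (h₁ : I ≠ Finset.univ) (h : gen K x * hatMonomial K I ≠ 0) : x ∈ I ∧ x + 1 ∉ I := by
  rw [hatMonomial, ← monomial_cons] at h
  obtain ⟨T, hT⟩ := exists_act_filled h
  obtain ⟨U, hU, hx, hx', -⟩ := act_cons_eq_some.1 hT
  obtain ⟨-, rfl⟩ := eq_of_act_hatWord h₀ h₁ hU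
  exact ⟨hx, hx'⟩

theorem of_hatMonomial_mul_gen_ne_zero {I : Finset (ZMod N)} {x : ZMod N} (h₀ : I.Nonempty)
    (h₁ : I ≠ Finset.univ) (h : hatMonomial K I * gen K x ≠ 0) :
    ∃ S : Finset (ZMod N), x ∈ S ∧ x + 1 ∉ S ∧ insert (x + 1) (S.erase x) = I := by
  have e : hatMonomial K I * gen K x = monomial K (hatWord (gap I) I ++ [x]) := by
    simp [hatMonomial]
  rw [e] at h
  obtain ⟨T, hT⟩ := exists_act_filled h
  obtain ⟨U, hU, hT⟩ := act_append_eq_some.1 hT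
  obtain ⟨hx, hx', hU⟩ := act_singleton_eq_some.1 hU
  obtain ⟨rfl, -⟩ := eq_of_act_hatWord h₀ h₁ hT
  exact ⟨_, hx, hx', hU.symm⟩

omit [Fact (1 < N)] in
theorem hatWord_perm (g g' : ZMod N) (I I' : Finset (ZMod N)) :
    (hatWord g I).Perm (hatWord g' I') :=
  (List.perm_ext_iff_of_nodup (hatWord_nodup g I) (hatWord_nodup g' I')).2 fun x =>
    iff_of_true (mem_hatWord g x I) (mem_hatWord g' x I')

omit [NeZero N] in
theorem card_insert_succ_erase {I : Finset (ZMod N)} {x : ZMod N} (hx : x ∈ I)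
    (hx' : x + 1 ∉ I) : (insert (x + 1) (I.erase x)).card = I.card :=
  card_act (act_singleton_eq_some.2 ⟨hx, hx', rfl⟩)

/-- Both sides are anagrams acting nontrivially on `I`. -/
theorem gen_mul_hatMonomial {I : Finset (ZMod N)} {x : ZMod N} (hx : x ∈ I) (hx' : x + 1 ∉ I) :
    gen K x * hatMonomial K I = hatMonomial K (insert (x + 1) (I.erase x)) * gen K x := by
  have hI : act (hatWord (gap I) I) I = some I :=
    act_hatWord_gap ⟨x, hx⟩ fun h => hx' (h ▸ Finset.mem_univ _)
  have hI' := act_hatWord_gap (I := insert (x + 1) (I.erase x)) ⟨x + 1, by simp⟩ fun h => by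
    have : x ∈ insert (x + 1) (I.erase x) := h ▸ Finset.mem_univ _
    simp at this
  have h₁ := act_cons_eq_some.2 ⟨I, hI, hx, hx', rfl⟩
  have h₂ := act_append_eq_some.2 ⟨_, act_singleton_eq_some.2 ⟨hx, hx', rfl⟩, hI'⟩
  have := monomial_eq_of_perm (K := K)
    (((hatWord_perm _ _ _ _).cons x).trans (List.perm_append_singleton x _).symm) h₁ h₂
  simpa [hatMonomial] using this

theorem t_mem_center {k : ℕ} (hk : 1 ≤ k) (hk' : k ≤ N - 1) :
    t K N k ∈ Subalgebra.center K (Alg K N) := by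
  refine mul_mem (neg_one_pow_mem_center _) (mem_center_of_commute_gen fun x => ?_)
  have hI : ∀ I ∈ (Finset.univ : Finset (ZMod N)).powersetCard k,
      I.Nonempty ∧ I ≠ Finset.univ := fun I h => by
    rw [Finset.mem_powersetCard_univ] at h
    exact ⟨Finset.card_pos.1 (h ▸ hk), ne_univ_of_card_le (h ▸ hk')⟩
  rw [Finset.mul_sum, Finset.sum_mul]
  -- Nonzero terms on the left come from the `I` on which `x` acts, those on the right from the
  -- results of such moves; the move matches them.
  refine Finset.sum_bij_ne_zero (fun I _ _ => insert (x + 1) (I.erase x)) ?_ ?_ ?_ ?_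
  · intro I h h'
    obtain ⟨hx, hx'⟩ := of_gen_mul_hatMonomial_ne_zero (hI I h).1 (hI I h).2 h'
    rw [Finset.mem_powersetCard_univ] at h ⊢
    rw [card_insert_succ_erase hx hx', h]
  · intro I h₁ h₂ J h₃ h₄ e
    obtain ⟨hx, hx'⟩ := of_gen_mul_hatMonomial_ne_zero (hI I h₁).1 (hI I h₁).2 h₂
    obtain ⟨hy, hy'⟩ := of_gen_mul_hatMonomial_ne_zero (hI J h₃).1 (hI J h₃).2 h₄
    ext z
    have := Finset.ext_iff.1 e z
    simp only [Finset.mem_insert, Finset.mem_erase] at this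
    by_cases hz : z = x
    · simp [hz, hx, hy]
    · by_cases hz' : z = x + 1
      · simp [hz', hx', hy']
      · simpa [hz, hz'] using this
  · intro J h h'
    obtain ⟨I, hx, hx', rfl⟩ := of_hatMonomial_mul_gen_ne_zero (hI J h).1 (hI J h).2 h'
    refine ⟨I, ?_, ?_, rfl⟩
    · rw [Finset.mem_powersetCard_univ] at h ⊢
      rw [← h, card_insert_succ_erase hx hx']
    · rwa [gen_mul_hatMonomial hx hx']
  · intro I h h'
    obtain ⟨hx, hx'⟩ := of_gen_mul_hatMonomial_ne_zero (hI I h).1 (hI I h).2 h'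
    exact gen_mul_hatMonomial hx hx'

end Center

/-! ### Factorization of nonzero monomials -/

section Factorization

variable {K : Type*} [Field K] {N : ℕ} [NeZero N] [Fact (1 < N)]

/-- A word acting nontrivially on `S` splits into full turns of the particles of `S` and a word
missing some letter. -/
theorem exists_eq_mul_hatMonomial_pow {S : Finset (ZMod N)} (h₀ : S.Nonempty)
    (h₁ : S ≠ Finset.univ) (m : ℕ) : ∀ {j : List (ZMod N)} {T : Finset (ZMod N)},
    j.length ≤ m → act j S = some T → ∃ (x : ZMod N) (f : List (ZMod N)) (n : ℕ), x ∉ f ∧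
      monomial K j = monomial K f * hatMonomial K S ^ n := by
  induction m with
  | zero =>
    intro j T hj _
    exact ⟨0, [], 0, by simp, by simp [List.length_eq_zero_iff.1 (Nat.le_zero.1 hj)]⟩
  | succ m ih =>
    intro j T hj hact
    by_cases hall : ∀ x, x ∈ j
    · obtain ⟨u, hu₁, hu₂, hu₃⟩ := exists_split (K := K) _ hact (act_hatWord_gap h₀ h₁)
        ((Multiset.le_iff_subset (Multiset.coe_nodup.2 (hatWord_nodup _ _))).2
          fun x _ => hall x)
      have hlen := hu₂.length_eq
      have hpos : 0 < (hatWord (gap S) S).length := List.length_pos_of_mem (mem_hatWord _ 0 _)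
      rw [List.length_append] at hlen
      obtain ⟨x, f, n, hx, hf⟩ := ih (by omega) hu₃
      refine ⟨x, f, n + 1, hx, ?_⟩
      rw [hu₁, monomial_append, hf, pow_succ, mul_assoc]; rfl
    · push Not at hall
      obtain ⟨x, hx⟩ := hall
      exact ⟨x, j, 0, hx, by simp⟩

/-- A nonzero product would act on some configuration, which must contain `I` and have its size. So
it is `I`, whose image `shift I` would be the only configuration `J` on which a(Ĵ) acts. -/
theorem hatMonomial_mul_rightWord_eq_zero {I J : Finset (ZMod N)} {g : ZMod N} (hg : g ∈ I)
    (hg' : g + 1 ∉ I) (hcard : J.card = I.card) (hJ : J ≠ shift I) :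
    hatMonomial K J * monomial K (rightWord g I) = 0 := by
  by_contra h
  rw [hatMonomial, ← monomial_append] at h
  obtain ⟨T, hT⟩ := exists_act_filled h
  obtain ⟨U, hU, hT⟩ := act_append_eq_some.1 hT
  have hI := act_rightWord hg hg'
  have hJ₀ : J.Nonempty := by
    rw [← Finset.card_pos, hcard]; exact Finset.card_pos.2 ⟨g, hg⟩
  have hJ₁ : J ≠ Finset.univ := fun e => by
    have : I = Finset.univ := Finset.eq_univ_of_card _ (by rw [← hcard, e, Finset.card_univ])
    exact hg' (this ▸ Finset.mem_univ _)
  obtain ⟨rfl, -⟩ := eq_of_act_hatWord hJ₀ hJ₁ hT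
  have hsub : I ⊆ filled (hatWord (gap U) U ++ rightWord g I) := fun x hx =>
    filled_subset hU <|
      (mem_filled_or_mem_emptied (.inl (mem_rightWord.2 hx))).resolve_right
        fun h => emptied_disjoint hI x h hx
  have := Finset.eq_of_subset_of_card_le hsub (by rw [← hcard, ← card_act hU])
  rw [← this] at hU
  exact hJ (Option.some.inj (hU.symm.trans hI))

omit [NeZero N] [Fact (1 < N)] in
theorem card_shift (I : Finset (ZMod N)) : (shift I).card = I.card :=
  Finset.card_image_of_injective _ (add_left_injective 1)

theorem t_mul_rightWord {I : Finset (ZMod N)} {g : ZMod N} (hg : g ∈ I) (hg' : g + 1 ∉ I) :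
    t K N I.card * monomial K (rightWord g I) =
      (-1) ^ (I.card - 1) * (hatMonomial K (shift I) * monomial K (rightWord g I)) := by
  rw [t, mul_assoc, Finset.sum_mul, Finset.sum_eq_single (shift I)]
  · intro J hJ hne
    exact hatMonomial_mul_rightWord_eq_zero hg hg' (Finset.mem_powersetCard_univ.1 hJ) hne
  · intro h
    exact absurd (Finset.mem_powersetCard_univ.2 (card_shift I)) h

omit [Fact (1 < N)] in
theorem card_bounds {I : Finset (ZMod N)} {g : ZMod N} (hg : g ∈ I) (hg' : g + 1 ∉ I) :
    1 ≤ I.card ∧ I.card ≤ N - 1 := by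
  have h₁ : I.card < N := by
    have := Finset.card_lt_univ_of_notMem hg'
    rwa [ZMod.card] at this
  exact ⟨Finset.card_pos.2 ⟨g, hg⟩, by omega⟩

/-- Only the factor adjacent to `rightWord g I` can be exchanged for ± t_k; centrality then moves
t_k away and exposes the next factor. -/
theorem hatMonomial_pow_mul_rightWord {I : Finset (ZMod N)} {g : ZMod N} (hg : g ∈ I)
    (hg' : g + 1 ∉ I) (n : ℕ) :
    hatMonomial K (shift I) ^ n * monomial K (rightWord g I) =
      (-1) ^ (n * (I.card - 1)) * (t K N I.card ^ n * monomial K (rightWord g I)) := by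
  obtain ⟨hk, hk'⟩ := card_bounds hg hg'
  have hc : Commute (t K N I.card) (hatMonomial K (shift I)) :=
    (Subalgebra.mem_center_iff.1 (t_mem_center hk hk') _).symm
  have hs : ∀ m, Commute ((-1 : Alg K N) ^ m) (hatMonomial K (shift I)) := fun m =>
    neg_one_pow_commute m _
  have hs' : ∀ m, Commute ((-1 : Alg K N) ^ m) (t K N I.card) := fun m =>
    neg_one_pow_commute m _
  have h1 : hatMonomial K (shift I) * monomial K (rightWord g I) =
      (-1) ^ (I.card - 1) * (t K N I.card * monomial K (rightWord g I)) := by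
    rw [t_mul_rightWord hg hg', ← mul_assoc, neg_one_pow_mul_self, one_mul]
  induction n with
  | zero => simp
  | succ n ih =>
    rw [pow_succ', mul_assoc, ih, ← mul_assoc, ← (hs _).eq, mul_assoc, ← mul_assoc (hatMonomial K _),
      ← (hc.pow_left n).eq, mul_assoc, h1, ← mul_assoc (t K N _ ^ n),
      ← ((hs' _).pow_right n).eq, Nat.succ_mul, pow_add, pow_succ]
    simp only [mul_assoc]

omit [NeZero N] [Fact (1 < N)] in
theorem exists_mem_of_act {j : List (ZMod N)} (hj : j ≠ []) {S T : Finset (ZMod N)}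
    (h : act j S = some T) : ∃ g ∈ S, g + 1 ∉ S := by
  obtain ⟨p, x, rfl⟩ := (List.eq_nil_or_concat' j).resolve_left hj
  obtain ⟨U, hU, -⟩ := act_append_eq_some.1 h
  obtain ⟨h₁, h₂, -⟩ := act_singleton_eq_some.1 hU
  exact ⟨x, h₁, h₂⟩

theorem monomial_factorization {j : List (ZMod N)} (hj : j ≠ []) (h : monomial K j ≠ 0) :
    ∃ (i : ZMod N) (f : List (ZMod N)) (n : ℕ) (j₀ : List (ZMod N)), i ∉ f ∧
      1 ≤ j₀.length ∧ j₀.length ≤ N - 1 ∧ j₀.Nodup ∧ j₀.toFinset = filled j ∧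
      monomial K j = (-1) ^ (n * (j₀.length - 1)) *
        (monomial K f * t K N j₀.length ^ n * monomial K j₀) := by
  obtain ⟨T, hT⟩ := exists_act_filled h
  obtain ⟨g, hg, hg'⟩ := exists_mem_of_act hj hT
  obtain ⟨hk, hk'⟩ := card_bounds hg hg'
  obtain ⟨u, hu, -, hact⟩ := exists_split (K := K) (rightWord g (filled j)) hT
    (act_rightWord hg hg')
    ((Multiset.le_iff_subset (Multiset.coe_nodup.2 (rightWord_nodup _ _))).2
      fun x hx => mem_of_mem_filled (mem_rightWord.1 hx))
  obtain ⟨i, f, n, hi, hf⟩ := exists_eq_mul_hatMonomial_pow (K := K)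
    (Finset.card_pos.1 (by rwa [card_shift]))
    (ne_univ_of_card_le (by rwa [card_shift])) _ le_rfl hact
  have hl := length_rightWord g (filled j)
  refine ⟨i, f, n, rightWord g (filled j), hi, by rwa [hl], by rwa [hl], rightWord_nodup _ _,
    toFinset_rightWord _ _, ?_⟩
  have hs : Commute ((-1 : Alg K N) ^ (n * ((filled j).card - 1))) (monomial K f) :=
    neg_one_pow_commute _ _
  rw [hl, hu, monomial_append, hf, mul_assoc, hatMonomial_pow_mul_rightWord hg hg', ← mul_assoc,
    ← hs.eq]
  simp only [mul_assoc]

end Factorization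

/-! ### Finite generation over the center -/

section Finiteness

variable {K : Type*} [Field K] {N : ℕ} [NeZero N] [Fact (1 < N)]

-- Particle balance at `x + 1`: letters `x` bring particles in, letters `x + 1` take them out.
omit [NeZero N] in
theorem count_add_eq (x : ZMod N) : ∀ {f : List (ZMod N)} {S T : Finset (ZMod N)},
    act f S = some T → f.count x + (if x + 1 ∈ S then 1 else 0) =
      f.count (x + 1) + (if x + 1 ∈ T then 1 else 0)
  | [], S, T, h => by simp at h; simp [h]
  | y :: f, S, T, h => by
    obtain ⟨U, hU, hy, hy', rfl⟩ := act_cons_eq_some.1 h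
    have ih := count_add_eq x hU
    simp only [List.count_cons, beq_iff_eq, Finset.mem_insert, Finset.mem_erase]
    by_cases h₁ : y = x
    · subst h₁
      simp [hy'] at ih ⊢
      omega
    · by_cases h₂ : y = x + 1
      · subst h₂
        simp [hy] at ih ⊢
        omega
      · have h₃ : x ≠ y := Ne.symm h₁
        have h₄ : x + 1 ≠ y := Ne.symm h₂
        simpa [h₁, h₂, h₃, h₄] using ih

/-- By particle balance, multiplicities of consecutive letters differ by at most one; starting from
the missing letter, none exceeds `N`. -/
theorem length_le_of_notMem {i : ZMod N} {f : List (ZMod N)} (hi : i ∉ f)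
    (h : monomial K f ≠ 0) : f.length ≤ N * N := by
  obtain ⟨T, hT⟩ := exists_act_filled h
  have key : ∀ m : ℕ, f.count (i + (m : ZMod N)) ≤ m := by
    intro m
    induction m with
    | zero => simp [List.count_eq_zero.2 hi]
    | succ m ih =>
      have := count_add_eq (i + (m : ZMod N)) hT
      rw [Nat.cast_succ, ← add_assoc]
      split_ifs at this <;> omega
  have hle : ∀ x, f.count x ≤ N := fun x => by
    have := key (x - i).val
    rw [ZMod.natCast_zmod_val, add_sub_cancel] at this
    exact this.trans (ZMod.val_lt _).le
  rw [← List.sum_toFinset_count_eq_length]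
  calc ∑ x ∈ f.toFinset, f.count x ≤ ∑ _x ∈ f.toFinset, N := Finset.sum_le_sum fun x _ => hle x
    _ = f.toFinset.card * N := by simp
    _ ≤ N * N := Nat.mul_le_mul_right _ (by
      have := Finset.card_le_univ f.toFinset
      rwa [ZMod.card] at this)

theorem finite_over_center : Module.Finite (Subalgebra.center K (Alg K N)) (Alg K N) := by
  -- The bound allows `N * N` for the factor missing a letter and `N` for the repetition-free one.
  let W : Set (List (ZMod N)) := {w | w.length ≤ N * N + N}
  have hW : W.Finite := List.finite_length_le _ _
  refine Module.finite_def.2 ⟨(hW.image (monomial K)).toFinset, ?_⟩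
  rw [Set.Finite.coe_toFinset, eq_top_iff]
  set F := Submodule.span (Subalgebra.center K (Alg K N)) (monomial K '' W)
  have hmem : ∀ j, monomial K j ∈ F := by
    intro j
    by_cases h : monomial K j = 0
    · rw [h]; exact zero_mem _
    rcases eq_or_ne j [] with rfl | hj
    · exact Submodule.subset_span ⟨[], by simp [W], rfl⟩
    obtain ⟨i, f, n, j₀, hi, hk, hk', -, -, e⟩ := monomial_factorization hj h
    have hf : monomial K f ≠ 0 := fun h0 => h (by rw [e, h0]; simp)
    let z : Subalgebra.center K (Alg K N) := (-1) ^ (n * (j₀.length - 1)) *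
      ⟨t K N j₀.length, t_mem_center hk hk'⟩ ^ n
    have e' : monomial K j = z • monomial K (f ++ j₀) := by
      have hc : monomial K f * t K N j₀.length ^ n = t K N j₀.length ^ n * monomial K f :=
        Subalgebra.mem_center_iff.1 (pow_mem (t_mem_center hk hk') n) _
      rw [e, hc, monomial_append, Subalgebra.smul_def]
      simp [z, mul_assoc]
    rw [e']
    refine Submodule.smul_mem _ _ (Submodule.subset_span ⟨_, ?_, rfl⟩)
    have := length_le_of_notMem hi hf
    simp only [W, Set.mem_ofPred_eq, List.length_append]
    omega
  have hle : Submodule.span K (Set.range (monomial K (N := N))) ≤ F.restrictScalars K :=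
    Submodule.span_le.2 (by rintro _ ⟨j, rfl⟩; exact hmem j)
  rw [span_range_monomial] at hle
  exact fun a _ => hle (Submodule.mem_top (x := a))

end Finiteness

theorem monomial_mem_finiteCopy {K : Type*} [Field K] {N : ℕ} {i : ZMod N} {f : List (ZMod N)}
    (h : i ∉ f) : monomial K f ∈ finiteCopy K i := by
  refine Subalgebra.list_prod_mem _ fun a ha => ?_
  obtain ⟨m, hm, rfl⟩ := List.mem_map.1 ha
  exact Algebra.subset_adjoin ⟨m, fun e => h (e ▸ hm), rfl⟩

end AffineNilTL

end

theorem theorem6p1 (K : Type*) [Field K] (N : ℕ) [NeZero N] (hN : 3 ≤ N) :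
    Module.Finite (Subalgebra.center K (AffineNilTL.Alg K N)) (AffineNilTL.Alg K N) ∧
    (∀ k : ℕ, 1 ≤ k → k ≤ N - 1 →
      AffineNilTL.t K N k ∈ Subalgebra.center K (AffineNilTL.Alg K N)) ∧
    ∀ j : List (ZMod N), ∃ (i : ZMod N) (f : List (ZMod N)) (k n : ℕ) (j₀ : List (ZMod N)),
      i ∉ f ∧ AffineNilTL.monomial K f ∈ AffineNilTL.finiteCopy K i ∧
      1 ≤ k ∧ k ≤ N - 1 ∧ j₀.Nodup ∧
      (AffineNilTL.monomial K j ≠ 0 →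
        IsLeast (AffineNilTL.support j) j₀.toFinset ∧ (j ≠ [] → k = j₀.length)) ∧
      AffineNilTL.monomial K j =
        (-1) ^ (n * (k - 1)) *
          (AffineNilTL.monomial K f * AffineNilTL.t K N k ^ n * AffineNilTL.monomial K j₀) := by
  have : Fact (1 < N) := ⟨by omega⟩
  refine ⟨AffineNilTL.finite_over_center, fun k hk hk' => AffineNilTL.t_mem_center hk hk',
    fun j => ?_⟩
  by_cases h : AffineNilTL.monomial K j = 0
  -- A vanishing monomial is matched by the finite part a_1² = 0, which avoids the letter 0.
  · have hf : (0 : ZMod N) ∉ [1, 1] := by simp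
    refine ⟨0, [1, 1], 1, 0, [], hf, AffineNilTL.monomial_mem_finiteCopy hf, le_rfl, by omega,
      List.nodup_nil, fun h' => absurd h h', ?_⟩
    simp [h, AffineNilTL.gen_mul_self]
  rcases eq_or_ne j [] with rfl | hj
  · exact ⟨0, [], 1, 0, [], by simp, AffineNilTL.monomial_mem_finiteCopy (by simp), le_rfl,
      by omega, List.nodup_nil,
      fun h => ⟨AffineNilTL.isLeast_filled h, fun h' => absurd rfl h'⟩, by simp⟩
  · obtain ⟨i, f, n, j₀, hi, hk, hk', hnd, hfin, e⟩ := AffineNilTL.monomial_factorization hj h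
    exact ⟨i, f, j₀.length, n, j₀, hi, AffineNilTL.monomial_mem_finiteCopy hi, hk, hk', hnd,
      fun h => ⟨hfin ▸ AffineNilTL.isLeast_filled h, fun _ => rfl⟩, e⟩
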